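/- Let $G=(V,E)$ be a finite, connected, simple, undirected, unweighted graph with at least one vertex, with shortest-path distance $d_G$. For a simple cycle $C$ of $G$ let $d_C$ denote the distance within $C$. Write $D_r(x)=\{y\in V: d_G(x,y)\le r\}$. Define the following integers. - $\mathrm{bnc}(G)$ is the least integer $r\ge 0$ such that, whenever $P$ is a shortest path of even length between two vertices $u,v$ of $G$ and $w$ is its middle vertex, every path between $u$ and $v$ contains a vertex at distance at most $r$ from $w$. - $\mathrm{cbc}(G)$ is the least integer $k\ge 1$ such that, for every simple cycle $C$ of $G$, every vertex $v$ of $C$ and its two $k$-neighbors $x,y$ in $C$ (the vertices of $C$ with $d_C(x,v)=d_C(y,v)=k$), if $d_G(x,y)=2k$, then some vertex $z$ of $C$ satisfies $d_G(v,z)\le k<d_C(v,z)$. - $\mathrm{bgc}(G)$: a simple cycle $C$ is $\mu$-locally geodesic if, for all vertices $x,y$ of $C$, $d_G(x,y)=d_C(x,y)=\ell$ implies $\ell\le\mu$. If $x,y\in C$ satisfy $d_G(x,y)=d_C(x,y)=\mu+1$, a part of $C$ between $x$ and $y$ (both included) of length $d_C(x,y)$ is called a side of non-$\mu$-locality. Then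 $\mathrm{bgc}(G)$ is the least integer $\mu\ge 1$ such that, for every simple cycle $C$ of $G$ that is not $\mu$-locally geodesic and every side $S$ of non-$\mu$-locality of $C$, there are a vertex $v$ of $S$ and a vertex $z$ of $C$ not in $S$ with $d_G(v,z)\le\lfloor(\mu+1)/2\rfloor<d_C(v,z)$. - $\mathrm{adt}(G)$ is the least integer $k\ge 0$ such that there is an (unweighted) tree $T$ with vertex set $V$ and $|d_G(u,v)-d_T(u,v)|\le k$ for all $u,v\in V$. - $\mathrm{mcw}(G)$ is the least integer $r\ge 0$ such that for every three vertices $u,v,w$ of $G$ there is a vertex $x$ such that no connected component of $G[V\setminus D_r(x)]$ contains two of $u,v,w$. Then $$\mathrm{bnc}(G)\le \mathrm{cbc}(G)\le \mathrm{bgc}(G)+1\le 2\,\mathrm{cbc}(G)\le 2\,\mathrm{bnc}(G)+2,$$ $$\frac{\mathrm{bgc}(G)-3}{6}\le\frac{\mathrm{bnc}(G)-1}{3}\le \mathrm{adt}(G)\le 4\,\mathrm{bnc}(G)+2\le 4\,\mathrm{bgc}(G)+6,$$ $$\frac{\mathrm{bgc}(G)-1}{6}\le \mathrm{mcw}(G)\le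 4\,\mathrm{bgc}(G)+6.$$ -/

import Mathlib

namespace SimpleGraph

/-- `r` is a bottleneck bound of `G`: whenever `P` is a shortest `u`-`v` path of even length with
middle vertex `w`, every `u`-`v` path has a vertex at distance at most `r` from `w`. -/
def IsBottleneckBound {V : Type*} (G : SimpleGraph V) (r : ℕ) : Prop :=
  ∀ (u v : V) (P : G.Walk u v), P.length = G.dist u v → Even P.length →
    ∀ Q : G.Walk u v, Q.IsPath →
      ∃ z ∈ Q.support, G.dist (P.getVert (P.length / 2)) z ≤ r

/-- The bottleneck constant of `G`. -/
noncomputable def bnc {V : Type*} (G : SimpleGraph V) : ℕ :=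
  sInf {r | G.IsBottleneckBound r}

/-- The distance between two vertices of a cycle `C` inside the cycle, i.e. in the graph that
consists of the vertices and edges of `C`. -/
noncomputable def cycleDist {V : Type*} {G : SimpleGraph V} {a : V} (C : G.Walk a a)
    (x y : V) : ℕ :=
  C.toSubgraph.spanningCoe.dist x y

/-- For every simple cycle `C` of `G`, every vertex `v` of `C` and its two `k`-neighbors `x`, `y` in
`C`: if `d_G(x, y) = 2k`, then some `z` on `C` satisfies `d_G(v, z) ≤ k < d_C(v, z)`.
(For `k ≥ 1`, the equation `d_G(x, y) = 2k` forces `x ≠ y`.) -/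
def IsCycleBridging {V : Type*} (G : SimpleGraph V) (k : ℕ) : Prop :=
  ∀ (a : V) (C : G.Walk a a), C.IsCycle →
    ∀ v ∈ C.support, ∀ x ∈ C.support, ∀ y ∈ C.support,
      cycleDist C x v = k → cycleDist C y v = k → G.dist x y = 2 * k →
        ∃ z ∈ C.support, G.dist v z ≤ k ∧ k < cycleDist C v z

/-- The cycle bridging constant of `G`. -/
noncomputable def cbc {V : Type*} (G : SimpleGraph V) : ℕ :=
  sInf {k | 1 ≤ k ∧ G.IsCycleBridging k}

/-- A cycle `C` is `μ`-locally geodesic if `d_G(x, y) = d_C(x, y) = ℓ` implies `ℓ ≤ μ`, for all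
vertices `x`, `y` of `C`. -/
def IsLocallyGeodesic {V : Type*} {G : SimpleGraph V} {a : V} (C : G.Walk a a) (μ : ℕ) : Prop :=
  ∀ x ∈ C.support, ∀ y ∈ C.support, ∀ ℓ : ℕ,
    G.dist x y = ℓ → cycleDist C x y = ℓ → ℓ ≤ μ

/-- `S` is (the vertex set of) a side of non-`μ`-locality of the cycle `C`: for some vertices `x`,
`y` of `C` with `d_G(x, y) = d_C(x, y) = μ + 1`, it is the vertex set of a part of `C` between `x`
and `y` (both included) of length `d_C(x, y)`. -/
def IsNonlocalSide {V : Type*} {G : SimpleGraph V} {a : V} (C : G.Walk a a) (μ : ℕ)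
    (S : Set V) : Prop :=
  ∃ x ∈ C.support, ∃ y ∈ C.support, G.dist x y = μ + 1 ∧ cycleDist C x y = μ + 1 ∧
    ∃ P : C.toSubgraph.spanningCoe.Walk x y,
      P.IsPath ∧ P.length = cycleDist C x y ∧ S = {z | z ∈ P.support}

/-- The vertices `v`, `z` of the cycle `C` form a `k`-bridge in `C`. -/
def IsBridgeIn {V : Type*} {G : SimpleGraph V} {a : V} (C : G.Walk a a) (k : ℕ) (v z : V) : Prop :=
  v ∈ C.support ∧ z ∈ C.support ∧ G.dist v z ≤ k ∧ k < cycleDist C v z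

/-- For every simple cycle `C` of `G` that is not `μ`-locally geodesic, from every side of
non-`μ`-locality there is a `⌊(μ + 1) / 2⌋`-bridge to the other side of `C`. -/
def IsNonlocalBridging {V : Type*} (G : SimpleGraph V) (μ : ℕ) : Prop :=
  ∀ (a : V) (C : G.Walk a a), C.IsCycle → ¬ IsLocallyGeodesic C μ →
    ∀ S : Set V, IsNonlocalSide C μ S →
      ∃ v ∈ S, ∃ z, z ∉ S ∧ IsBridgeIn C ((μ + 1) / 2) v z

/-- The "bridging non-locally geodesic cycles" constant of `G`. -/
noncomputable def bgc {V : Type*} (G : SimpleGraph V) : ℕ :=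
  sInf {μ | 1 ≤ μ ∧ G.IsNonlocalBridging μ}

/-- `T` is a distance `k`-approximating tree of `G` (an unweighted tree on the same vertex set). -/
def IsDistApproxTree {V : Type*} (G T : SimpleGraph V) (k : ℕ) : Prop :=
  T.IsTree ∧ ∀ u v : V, |(G.dist u v : ℤ) - (T.dist u v : ℤ)| ≤ k

/-- The minimum `k` such that `G` has a distance `k`-approximating tree. -/
noncomputable def adt {V : Type*} (G : SimpleGraph V) : ℕ :=
  sInf {k | ∃ T : SimpleGraph V, G.IsDistApproxTree T k}

/-- The disk of radius `r` centered at `x`. -/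
def disk {V : Type*} (G : SimpleGraph V) (x : V) (r : ℕ) : Set V :=
  {y | G.dist y x ≤ r}

/-- For every three vertices `u`, `v`, `w` there is a vertex `x` such that no connected component of
`G` minus the disk of radius `r` around `x` contains two of `u`, `v`, `w`. -/
def IsMcCartyBound {V : Type*} (G : SimpleGraph V) (r : ℕ) : Prop :=
  ∀ u v w : V, u ≠ v → u ≠ w → v ≠ w →
    ∃ x : V, ∀ K : (G.induce (G.disk x r)ᶜ).ConnectedComponent,
      ¬ ∃ p ∈ ({u, v, w} : Set V), ∃ q ∈ ({u, v, w} : Set V), p ≠ q ∧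
        p ∈ Subtype.val '' K.supp ∧ q ∈ Subtype.val '' K.supp

/-- The McCarty-width of `G`. -/
noncomputable def mcw {V : Type*} (G : SimpleGraph V) : ℕ :=
  sInf {r | G.IsMcCartyBound r}

/-! In a finite connected graph all these minima are attained, so no infimum of an empty set is
involved. -/

theorem exists_dist_le {V : Type*} [Finite V] (G : SimpleGraph V) :
    ∃ N : ℕ, ∀ x y : V, G.dist x y ≤ N := by
  obtain ⟨N, hN⟩ := (Set.finite_range fun p : V × V => G.dist p.1 p.2).bddAbove
  exact ⟨N, fun x y => hN ⟨(x, y), rfl⟩⟩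

theorem isLeast_bnc {V : Type*} [Finite V] (G : SimpleGraph V) :
    IsLeast {r | G.IsBottleneckBound r} G.bnc := by
  obtain ⟨N, hN⟩ := exists_dist_le G
  have hne : {r | G.IsBottleneckBound r}.Nonempty :=
    ⟨N, fun u _ _ _ _ Q _ => ⟨u, Q.start_mem_support, hN _ _⟩⟩
  exact ⟨Nat.sInf_mem hne, fun _ h => Nat.sInf_le h⟩

theorem isLeast_cbc {V : Type*} [Finite V] (G : SimpleGraph V) :
    IsLeast {k | 1 ≤ k ∧ G.IsCycleBridging k} G.cbc := by
  obtain ⟨N, hN⟩ := exists_dist_le G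
  have hne : {k | 1 ≤ k ∧ G.IsCycleBridging k}.Nonempty := by
    refine ⟨N + 1, by omega, ?_⟩
    intro a C _ v _ x _ y _ _ _ h
    have := hN x y
    omega
  exact ⟨Nat.sInf_mem hne, fun _ h => Nat.sInf_le h⟩

theorem isLeast_bgc {V : Type*} [Finite V] (G : SimpleGraph V) :
    IsLeast {μ | 1 ≤ μ ∧ G.IsNonlocalBridging μ} G.bgc := by
  obtain ⟨N, hN⟩ := exists_dist_le G
  have hne : {μ | 1 ≤ μ ∧ G.IsNonlocalBridging μ}.Nonempty := by
    refine ⟨N + 1, by omega, ?_⟩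
    rintro a C _ _ S ⟨x, _, y, _, h, _⟩
    have := hN x y
    omega
  exact ⟨Nat.sInf_mem hne, fun _ h => Nat.sInf_le h⟩

theorem isLeast_adt {V : Type*} [Finite V] (G : SimpleGraph V) (hG : G.Connected) :
    IsLeast {k | ∃ T : SimpleGraph V, G.IsDistApproxTree T k} G.adt := by
  obtain ⟨T, _, hT⟩ := hG.exists_isTree_le
  obtain ⟨N, hN⟩ := exists_dist_le G
  obtain ⟨M, hM⟩ := exists_dist_le T
  have hne : {k | ∃ T : SimpleGraph V, G.IsDistApproxTree T k}.Nonempty := by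
    refine ⟨N + M, T, hT, fun u v => ?_⟩
    have h1 := hN u v
    have h2 := hM u v
    rw [abs_le]
    constructor <;> push_cast <;> omega
  exact ⟨Nat.sInf_mem hne, fun _ h => Nat.sInf_le h⟩

theorem isLeast_mcw {V : Type*} [Finite V] (G : SimpleGraph V) :
    IsLeast {r | G.IsMcCartyBound r} G.mcw := by
  obtain ⟨N, hN⟩ := exists_dist_le G
  have hne : {r | G.IsMcCartyBound r}.Nonempty := by
    refine ⟨N, fun u v w _ _ _ => ⟨u, ?_⟩⟩
    rintro K ⟨p, _, q, _, _, ⟨p', _, _⟩, _⟩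
    exact p'.2 (hN _ _)
  exact ⟨Nat.sInf_mem hne, fun _ h => Nat.sInf_le h⟩

end SimpleGraph

/-! Each inequality turns a bound for one parameter into a bound for another.

Cycle parameters: `exists_arcs` splits a cycle at the two `k`-neighbours of `v` into a geodesic arc
through `v` and a complementary path. A bottleneck on the complementary path is a bridge, so `cbc ≤
bnc + 1`. Conversely, a path that avoids a disk around the middle of a geodesic closes a central
segment to a cycle without a bridge, so `bnc ≤ cbc`. Applying bridging at the midpoint of a nonlocal
side gives `bgc ≤ 2 * cbc - 1`; applying nonlocal bridging to a side centred at `v` gives `cbc ≤ bgc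
+ 1`.

Lower bounds for `adt` and `mcw`: a vertex of an approximating tree, or a separating disk, must lie
near the middle of a geodesic and be met or jumped over by every path with the same ends. Hence `bnc
≤ 3 * adt + 1` and `bnc ≤ 3 * mcw`.

Upper bounds: fix a root `s` and call two vertices of layer `j` equivalent if they are connected
within the layers at least `j`. By `IsBottleneckBound.dist_le_of_upReachable` these clusters have
diameter at most `4 * r + 2`. Giving all vertices of a cluster one common parent produces the
approximating tree, and a disk around a vertex of a suitable cluster separates any three vertices.
-/

namespace SimpleGraph

/-! ### Segments of walks, geodesics and cycles -/

namespace Walk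

variable {V : Type*} {G : SimpleGraph V} {u v : V}

theorem exists_slice (p : G.Walk u v) {i j : ℕ} (hij : i ≤ j) (hj : j ≤ p.length) :
    ∃ q : G.Walk (p.getVert i) (p.getVert j), q.length = j - i ∧ q.IsSubwalk p ∧
      ∀ l ≤ j - i, q.getVert l = p.getVert (i + l) := by
  have h : (p.drop i).getVert (j - i) = p.getVert j := by
    rw [drop_getVert]; congr 1; omega
  rw [← h]
  refine ⟨(p.drop i).take (j - i), ?_, ?_, ?_⟩
  · simp only [take_length, drop_length]; omega
  · exact (isSubwalk_take _ _).trans (isSubwalk_drop _ _)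
  · intro l hl
    rw [take_getVert, drop_getVert, min_eq_right hl]

theorem dist_getVert {p : G.Walk u v} (hp : p.length = G.dist u v) {i j : ℕ} (hij : i ≤ j)
    (hj : j ≤ p.length) : G.dist (p.getVert i) (p.getVert j) = j - i := by
  obtain ⟨q, hq, hs, -⟩ := p.exists_slice hij hj
  rw [← length_eq_dist_of_subwalk hp hs, hq]

theorem exists_isPath (p : G.Walk u v) :
    ∃ q : G.Walk u v, q.IsPath ∧ ∀ z ∈ q.support, z ∈ p.support := by
  classical
  exact ⟨p.bypass, p.bypass_isPath, fun _ h => p.support_bypass_subset_support h⟩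

theorem IsCycle.getVert_eq_getVert {C : G.Walk u u} (hC : C.IsCycle) {i j : ℕ}
    (hi : i ≤ C.length) (hj : j ≤ C.length) (h : C.getVert i = C.getVert j) :
    i = j ∨ (i = 0 ∧ j = C.length) ∨ (i = C.length ∧ j = 0) := by
  rcases Nat.eq_zero_or_pos i with rfl | hi0
  · rw [getVert_zero, eq_comm, hC.getVert_endpoint_iff hj] at h
    omega
  rcases Nat.eq_zero_or_pos j with rfl | hj0
  · rw [getVert_zero, hC.getVert_endpoint_iff hi] at h
    omega
  exact Or.inl (hC.getVert_injOn ⟨hi0, hi⟩ ⟨hj0, hj⟩ h)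

end Walk

variable {V : Type*} {G : SimpleGraph V} {a x y : V}

/-! ### Distances inside a cycle -/

theorem exists_walk_spanningCoe {C : G.Walk a a} (p : G.Walk x y) (h : p.edges ⊆ C.edges) :
    ∃ q : C.toSubgraph.spanningCoe.Walk x y, q.length = p.length ∧ q.support = p.support := by
  have h' : ∀ e ∈ p.edges, e ∈ C.toSubgraph.spanningCoe.edgeSet := by
    intro e he
    rw [Subgraph.edgeSet_spanningCoe, Walk.mem_edges_toSubgraph]
    exact h he
  exact ⟨p.transfer _ h', by simp, by simp⟩

theorem cycleDist_comm (C : G.Walk a a) (x y : V) : cycleDist C x y = cycleDist C y x :=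
  dist_comm

theorem cycleDist_rotate [DecidableEq V] (C : G.Walk a a) (hx : x ∈ C.support) :
    cycleDist (C.rotate x hx) = cycleDist C := by
  unfold cycleDist
  rw [Walk.toSubgraph_rotate]

theorem reachable_spanningCoe {C : G.Walk a a} (hx : x ∈ C.support) (hy : y ∈ C.support) :
    C.toSubgraph.spanningCoe.Reachable x y := by
  classical
  have key : ∀ z ∈ C.support, C.toSubgraph.spanningCoe.Reachable a z := fun z hz =>
    (exists_walk_spanningCoe _ (C.edges_takeUntil_subset_edges hz)).choose.reachable
  exact (key x hx).symm.trans (key y hy)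

theorem dist_le_cycleDist {C : G.Walk a a} (hx : x ∈ C.support) (hy : y ∈ C.support) :
    G.dist x y ≤ cycleDist C x y :=
  (reachable_spanningCoe hx hy).dist_anti (Subgraph.spanningCoe_le _)

theorem cycleDist_le_length {C : G.Walk a a} (p : G.Walk x y) (h : p.edges ⊆ C.edges) :
    cycleDist C x y ≤ p.length := by
  obtain ⟨q, hq, -⟩ := exists_walk_spanningCoe p h
  exact hq ▸ dist_le q

theorem mem_support_of_spanningCoe_walk {C : G.Walk a a} (hx : x ∈ C.support)
    (q : C.toSubgraph.spanningCoe.Walk x y) {z : V} (hz : z ∈ q.support) : z ∈ C.support := by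
  induction q with
  | nil => simp only [Walk.support_nil, List.mem_singleton] at hz; exact hz ▸ hx
  | cons h q ih =>
    rcases List.mem_cons.1 (Walk.support_cons h q ▸ hz) with rfl | hz
    · exact hx
    · exact ih (Walk.mem_support_of_adj_toSubgraph h.symm) hz

/-- Each step inside the cycle changes the index by one modulo the length, so after `l` steps the
index is within `l` of `0` or of `C.length`. This is the lower bound in `cycleDist_getVert`. -/
theorem exists_getVert_eq_of_spanningCoe_walk {C : G.Walk a a} (hC : C.IsCycle)
    (q : C.toSubgraph.spanningCoe.Walk a y) {l : ℕ} (hl : l ≤ q.length) :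
    ∃ i ≤ C.length, C.getVert i = q.getVert l ∧ (i ≤ l ∨ C.length ≤ i + l) := by
  induction l with
  | zero => exact ⟨0, by simp, by simp, by simp⟩
  | succ l ih =>
    obtain ⟨i, hi, he, hil⟩ := ih (by omega)
    have hadj : C.toSubgraph.Adj (q.getVert l) (q.getVert (l + 1)) :=
      q.adj_getVert_succ (by omega)
    rw [Walk.toSubgraph_adj_iff] at hadj
    obtain ⟨j, hj, hjn⟩ := hadj
    have h3 := hC.three_le_length
    rcases Sym2.eq_iff.1 hj with ⟨h1, h2⟩ | ⟨h1, h2⟩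
    · rcases hC.getVert_eq_getVert hi hjn.le (he.trans h1.symm) with h | h | h
      · exact ⟨j + 1, by omega, h2, by omega⟩
      · omega
      · exact ⟨j + 1, by omega, h2, by omega⟩
    · rcases hC.getVert_eq_getVert hi (j := j + 1) hjn (he.trans h2.symm) with h | h | h
      · exact ⟨j, by omega, h1, by omega⟩
      · exact ⟨j, by omega, h1, by omega⟩
      · omega

theorem cycleDist_getVert {C : G.Walk a a} (hC : C.IsCycle) {i : ℕ} (hi : i ≤ C.length) :
    cycleDist C a (C.getVert i) = min i (C.length - i) := by
  apply le_antisymm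
  · apply le_min
    · refine (cycleDist_le_length (C.take i) ?_).trans (by simp)
      rw [Walk.edges_take]
      exact List.take_subset _ _
    · rw [cycleDist_comm]
      refine (cycleDist_le_length (C.drop i) ?_).trans (by simp)
      rw [Walk.edges_drop]
      exact List.drop_subset _ _
  · obtain ⟨q, hq⟩ := (reachable_spanningCoe C.start_mem_support
      (C.getVert_mem_support i)).exists_walk_length_eq_dist
    obtain ⟨j, hj, he, hjl⟩ := exists_getVert_eq_of_spanningCoe_walk hC q le_rfl
    rw [Walk.getVert_length] at he
    have hd : cycleDist C a (C.getVert i) = q.length := hq.symm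
    rw [hd]
    rcases hC.getVert_eq_getVert hj hi he with h | h | h <;> omega

/-- Two vertices `x`, `y` at distance `k` from a vertex `v` in a cycle split it into an arc of
length `2 * k` with middle vertex `v`, and a path farther away from `v`. -/
theorem exists_arcs {C : G.Walk a a} (hC : C.IsCycle) {v : V} (hv : v ∈ C.support)
    (hx : x ∈ C.support) (hy : y ∈ C.support) {k : ℕ} (hxv : cycleDist C x v = k)
    (hyv : cycleDist C y v = k) (hxy : x ≠ y) :
    ∃ A : C.toSubgraph.spanningCoe.Walk x y, A.length = 2 * k ∧ A.getVert k = v ∧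
      (∀ z ∈ C.support, cycleDist C v z ≤ k → z ∈ A.support) ∧
      ∃ Q : G.Walk x y, Q.IsPath ∧ ∀ z ∈ Q.support,
        z ∈ C.support ∧ (z = x ∨ z = y ∨ k < cycleDist C v z) := by
  classical
  -- reduce to the case where the cycle starts at `v`
  suffices H : ∀ {v : V} (C : G.Walk v v), C.IsCycle → ∀ i ≤ C.length, ∀ j ≤ C.length, i < j →
      cycleDist C v (C.getVert i) = k → cycleDist C v (C.getVert j) = k →
      C.getVert i ≠ C.getVert j →
      ∃ A : C.toSubgraph.spanningCoe.Walk (C.getVert i) (C.getVert j),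
        A.length = 2 * k ∧ A.getVert k = v ∧
        (∀ z ∈ C.support, cycleDist C v z ≤ k → z ∈ A.support) ∧
        ∃ Q : G.Walk (C.getVert i) (C.getVert j), Q.IsPath ∧ ∀ z ∈ Q.support,
          z ∈ C.support ∧ (z = C.getVert i ∨ z = C.getVert j ∨ k < cycleDist C v z) by
    have hS : (C.rotate v hv).toSubgraph = C.toSubgraph := Walk.toSubgraph_rotate _ _
    have hmem : ∀ z, z ∈ (C.rotate v hv).support ↔ z ∈ C.support :=
      fun z => Walk.mem_support_rotate_iff C v hv
    obtain ⟨i, rfl, hi⟩ := Walk.mem_support_iff_exists_getVert.1 ((hmem x).2 hx)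
    obtain ⟨j, rfl, hj⟩ := Walk.mem_support_iff_exists_getVert.1 ((hmem y).2 hy)
    rw [cycleDist_comm] at hxv hyv
    have hC' : (C.rotate v hv).IsCycle := by simpa using hC
    have hij : i ≠ j := fun h => hxy (by rw [h])
    rcases lt_or_gt_of_ne hij with hij | hij
    · have := H (C.rotate v hv) hC' i hi j hj hij (by rwa [cycleDist_rotate])
        (by rwa [cycleDist_rotate]) hxy
      simp only [cycleDist_rotate, hmem] at this
      rwa [hS] at this
    · have := H (C.rotate v hv) hC' j hj i hi hij (by rwa [cycleDist_rotate])
        (by rwa [cycleDist_rotate]) hxy.symm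
      simp only [cycleDist_rotate, hmem] at this
      rw [hS] at this
      obtain ⟨A, h1, h2, h3, Q, h4, h5⟩ := this
      refine ⟨A.reverse, by simpa using h1, ?_, by simpa using h3, Q.reverse, h4.reverse, ?_⟩
      · have e : 2 * k - k = k := by omega
        rw [Walk.getVert_reverse, h1, e, h2]
      · intro z hz
        have := h5 z (by simpa using hz)
        tauto
  intro v C hC i hi j hj hij hki hkj hne
  rw [cycleDist_getVert hC hi] at hki
  rw [cycleDist_getVert hC hj] at hkj
  -- The indices `0` and `C.length` name the same vertex; once this pair is excluded, `i < j` forces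
  -- `i = k` and `j = C.length - k`.
  have hk0 : i ≠ 0 ∨ j ≠ C.length := by
    by_contra! h
    rw [h.1, h.2] at hne
    simp at hne
  have hik : i = k := by omega
  have hjk : j + k = C.length := by omega
  subst hik
  obtain ⟨A₁, h₁, s₁⟩ := exists_walk_spanningCoe (C := C) (C.take i)
    (by rw [Walk.edges_take]; exact List.take_subset _ _)
  obtain ⟨A₂, h₂, s₂⟩ := exists_walk_spanningCoe (C := C) (C.drop j)
    (by rw [Walk.edges_drop]; exact List.drop_subset _ _)
  rw [Walk.take_length, min_eq_left hi] at h₁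
  rw [Walk.drop_length] at h₂
  refine ⟨A₁.reverse.append A₂.reverse, ?_, ?_, ?_, ?_⟩
  · simp only [Walk.length_append, Walk.length_reverse]; omega
  · rw [Walk.getVert_append, Walk.length_reverse, h₁]
    simp
  · intro z hz hzk
    obtain ⟨l, rfl, hl⟩ := Walk.mem_support_iff_exists_getVert.1 hz
    rw [cycleDist_getVert hC hl] at hzk
    rw [Walk.mem_support_append_iff, Walk.support_reverse, Walk.support_reverse,
      List.mem_reverse, List.mem_reverse, s₁, s₂]
    rcases min_le_iff.1 hzk with h | h
    · left
      have := (C.take i).getVert_mem_support l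
      rwa [Walk.take_getVert, min_eq_right h] at this
    · right
      have := (C.drop j).getVert_mem_support (l - j)
      rwa [Walk.drop_getVert, Nat.add_sub_cancel' (by omega)] at this
  · obtain ⟨Q, hQ, -, hQv⟩ := C.exists_slice hij.le hj
    refine ⟨Q, ?_, ?_⟩
    · rw [← Walk.IsPath.getVert_injOn_iff]
      intro l hl m hm h
      simp only [Set.mem_ofPred_eq, hQ] at hl hm
      rw [hQv l hl, hQv m hm] at h
      have := hC.getVert_eq_getVert (by omega) (by omega) h
      omega
    · intro z hz
      obtain ⟨l, rfl, hl⟩ := Walk.mem_support_iff_exists_getVert.1 hz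
      rw [hQ] at hl
      rw [hQv l hl]
      refine ⟨C.getVert_mem_support _, ?_⟩
      rw [cycleDist_getVert hC (by omega)]
      by_cases hl0 : l = 0
      · left; rw [hl0, add_zero]
      by_cases hl1 : i + l = j
      · right; left; rw [hl1]
      right; right; omega

end SimpleGraph
-- Comparison of `bnc`, `cbc` and `bgc`
namespace SimpleGraph

variable {V : Type*} {G : SimpleGraph V}

theorem cycleDist_getVert_le {a x y : V} {C : G.Walk a a} {p : G.Walk x y} (h : p.edges ⊆ C.edges)
    {i j : ℕ} (hij : i ≤ j) (hj : j ≤ p.length) :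
    cycleDist C (p.getVert i) (p.getVert j) ≤ j - i := by
  obtain ⟨q, hq, hs, -⟩ := p.exists_slice hij hj
  rw [← hq]
  exact cycleDist_le_length q fun e he => h (hs.edges_subset he)

/-- If `Q` misses the disk of radius `k` around `w`, the central segment `M` of length `2 * k` is
closed to a cycle by a path `W` that meets this disk only at its ends. The far end `z` of a bridge
from `w` would then lie on `M`, where the distance to `w` inside the cycle is at most `k`. -/
theorem IsCycleBridging.isBottleneckBound {k : ℕ} (hk : 1 ≤ k)
    (h : G.IsCycleBridging k) : G.IsBottleneckBound k := by
  intro u v P hP hE Q hQ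
  by_contra! hfar
  set m := P.length / 2 with hm
  have h2m : P.length = 2 * m := by obtain ⟨t, ht⟩ := hE; omega
  set w := P.getVert m with hw
  have hdw : ∀ l ≤ P.length, G.dist w (P.getVert l) = (l - m) + (m - l) := by
    intro l hl
    rcases le_total l m with hlm | hlm
    · rw [dist_comm, Walk.dist_getVert hP hlm (by omega)]; omega
    · rw [Walk.dist_getVert hP hlm hl]; omega
  have hkm : k < m := by
    have := hfar u Q.start_mem_support
    have h0 := hdw 0 (by omega)
    rw [Walk.getVert_zero] at h0
    omega
  obtain ⟨x, y, hx, hy, M, hM, hMP, hMv⟩ : ∃ x y, x = P.getVert (m - k) ∧ y = P.getVert (m + k) ∧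
      ∃ M : G.Walk x y, M.length = m + k - (m - k) ∧ M.IsSubwalk P ∧
        ∀ l ≤ m + k - (m - k), M.getVert l = P.getVert (m - k + l) :=
    ⟨_, _, rfl, rfl, P.exists_slice (by omega) (by omega)⟩
  have hPp := P.isPath_of_length_eq_dist hP
  have hMpath : M.IsPath := Walk.isPath_of_isSubwalk hMP hPp
  have hMmem : ∀ z, z ∈ M.support ↔ ∃ l, m - k ≤ l ∧ l ≤ m + k ∧ z = P.getVert l := by
    intro z
    rw [Walk.mem_support_iff_exists_getVert]
    constructor
    · rintro ⟨l, rfl, hl⟩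
      exact ⟨m - k + l, by omega, by omega, hMv l (by omega)⟩
    · rintro ⟨l, h1, h2, rfl⟩
      refine ⟨l - (m - k), ?_, by omega⟩
      rw [hMv _ (by omega)]; congr 1; omega
  -- a path from `y` to `x` outside the disk around `w`
  obtain ⟨W, hW, hWs⟩ : ∃ W : G.Walk y x, W.IsPath ∧ ∀ z ∈ W.support,
      z ∈ (((P.drop (m + k)).append Q.reverse).append (P.take (m - k))).support := by
    rw [hx, hy]
    exact Walk.exists_isPath _
  have hWfar : ∀ z ∈ W.support, z = x ∨ z = y ∨ k < G.dist w z := by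
    intro z hz
    have := hWs z hz
    rw [Walk.mem_support_append_iff, Walk.mem_support_append_iff] at this
    rcases this with (h1 | h1) | h1
    · obtain ⟨l, rfl, hl⟩ := Walk.mem_support_iff_exists_getVert.1 h1
      rw [Walk.drop_length] at hl
      rw [Walk.drop_getVert]
      by_cases hl0 : l = 0
      · right; left; rw [hl0, add_zero, hy]
      · right; right; rw [hdw _ (by omega)]; omega
    · right; right
      exact hfar z (by simpa using h1)
    · obtain ⟨l, rfl, hl⟩ := Walk.mem_support_iff_exists_getVert.1 h1
      rw [Walk.take_length] at hl
      rw [Walk.take_getVert, min_eq_right (by omega)]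
      by_cases hl0 : l = m - k
      · left; rw [hl0, hx]
      · right; right; rw [hdw _ (by omega)]; omega
  have hC : (M.append W).IsCycle := by
    refine hMpath.isCycle_append hW ?_ (Or.inl (by omega))
    intro z hz hz'
    have hMn := hMpath.support_nodup
    have hWn := hW.support_nodup
    rw [← Walk.cons_tail_support, List.nodup_cons] at hMn hWn
    rcases hWfar z (List.mem_of_mem_tail hz') with rfl | rfl | h1
    · exact hMn.1 hz
    · exact hWn.1 hz'
    · obtain ⟨l, h2, h3, rfl⟩ := (hMmem z).1 (List.mem_of_mem_tail hz)
      rw [hdw l (by omega)] at h1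
      omega
  have hsub : ∀ z ∈ M.support, z ∈ (M.append W).support := fun z hz =>
    Walk.support_subset_support_append_left _ _ hz
  -- the arc of the cycle around `w` is part of the given shortest path
  have hcd : ∀ l, m - k ≤ l → l ≤ m + k →
      cycleDist (M.append W) w (P.getVert l) ≤ (l - m) + (m - l) := by
    intro l hl hl'
    have hedges : M.edges ⊆ (M.append W).edges := by simp
    have hMl := hMv (l - (m - k)) (by omega)
    rw [Nat.add_sub_cancel' hl] at hMl
    have hMw := hMv k (by omega)
    rw [Nat.sub_add_cancel (by omega)] at hMw
    rw [hw, ← hMl, ← hMw]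
    rcases le_total l m with h1 | h1
    · rw [cycleDist_comm]
      exact (cycleDist_getVert_le hedges (by omega) (by omega)).trans (by omega)
    · exact (cycleDist_getVert_le hedges (by omega) (by omega)).trans (by omega)
  have hwC : w ∈ (M.append W).support := hsub _ ((hMmem _).2 ⟨m, by omega, by omega, rfl⟩)
  have hxC : x ∈ (M.append W).support := hsub _ M.start_mem_support
  have hyC : y ∈ (M.append W).support := hsub _ M.end_mem_support
  obtain ⟨z, hz, hz1, hz2⟩ := h _ (M.append W) hC w hwC x hxC y hyC
    (by
      have h1 := hcd (m - k) le_rfl (by omega)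
      have h2 := dist_le_cycleDist hwC hxC
      rw [← hx] at h1
      have h3 := hdw (m - k) (by omega)
      rw [← hx] at h3
      rw [cycleDist_comm]
      omega)
    (by
      have h1 := hcd (m + k) (by omega) le_rfl
      have h2 := dist_le_cycleDist hwC hyC
      rw [← hy] at h1
      have h3 := hdw (m + k) (by omega)
      rw [← hy] at h3
      rw [cycleDist_comm]
      omega)
    (by rw [hx, hy, Walk.dist_getVert hP (by omega) (by omega)]; omega)
  have hzM : z ∈ M.support := by
    rcases (Walk.mem_support_append_iff _ _).1 hz with h1 | h1
    · exact h1
    · rcases hWfar z h1 with rfl | rfl | h2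
      · exact M.start_mem_support
      · exact M.end_mem_support
      · omega
  obtain ⟨l, h1, h2, rfl⟩ := (hMmem z).1 hzM
  have := hcd l h1 h2
  omega

theorem IsCycleBridging.isNonlocalBridging {k : ℕ} (hk : 1 ≤ k) (h : G.IsCycleBridging k) :
    G.IsNonlocalBridging (2 * k - 1) := by
  rintro a C hC - S ⟨x, hx, y, hy, hxy, hCxy, P, hP, hPl, rfl⟩
  have hl : P.length = 2 * k := by omega
  have hv : P.getVert k ∈ C.support :=
    mem_support_of_spanningCoe_walk hx P (P.getVert_mem_support k)
  have hd : ∀ l ≤ 2 * k, cycleDist C (P.getVert k) (P.getVert l) = (l - k) + (k - l) := by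
    intro l hlk
    rcases le_total l k with h1 | h1
    · rw [cycleDist_comm]
      refine (Walk.dist_getVert hPl h1 (by omega)).trans (by omega)
    · refine (Walk.dist_getVert hPl h1 (by omega)).trans (by omega)
  have hd0 := hd 0 (by omega)
  have hd1 := hd (2 * k) le_rfl
  rw [Walk.getVert_zero] at hd0
  rw [← hl, Walk.getVert_length] at hd1
  obtain ⟨z, hz, hz1, hz2⟩ := h a C hC _ hv x hx y hy (by rw [cycleDist_comm]; omega)
    (by rw [cycleDist_comm]; omega) (by omega)
  have hk2 : (2 * k - 1 + 1) / 2 = k := by omega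
  refine ⟨P.getVert k, P.getVert_mem_support k, z, ?_, hv, hz, by omega, by omega⟩
  intro hzS
  obtain ⟨l, rfl, hl'⟩ := Walk.mem_support_iff_exists_getVert.1 hzS
  have := hd l (by omega)
  omega

/-- The ends `x`, `y` are at distance exactly `r + 1` from `v` in `G`, so the bottleneck vertex on
the complementary path is neither of them. This is why `r` is increased by one. -/
theorem IsBottleneckBound.isCycleBridging (hG : G.Connected) {r : ℕ} (h : G.IsBottleneckBound r) :
    G.IsCycleBridging (r + 1) := by
  intro a C hC v hv x hx y hy hxv hyv hxy
  have hne : x ≠ y := by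
    rintro rfl
    simp at hxy
  obtain ⟨A, hA, hAv, -, Q, hQ, hQs⟩ := exists_arcs hC hv hx hy hxv hyv hne
  obtain ⟨z, hz, hzr⟩ := h x y (A.mapLe (Subgraph.spanningCoe_le _)) (by simp [hA, hxy])
    (by simp [hA]) Q hQ
  have hmid : (A.mapLe (Subgraph.spanningCoe_le _)).getVert
      ((A.mapLe (Subgraph.spanningCoe_le _)).length / 2) = v := by
    simp [hA, hAv]
  rw [hmid] at hzr
  have htri := hG.dist_triangle (u := x) (v := v) (w := y)
  have h1 := dist_le_cycleDist hx hv
  have h2 := dist_le_cycleDist hv hy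
  rw [cycleDist_comm] at h2
  obtain ⟨hzC, rfl | rfl | hzk⟩ := hQs z hz
  · rw [dist_comm] at hzr
    omega
  · omega
  · exact ⟨z, hzC, by omega, hzk⟩

theorem IsNonlocalBridging.isCycleBridging (hG : G.Connected) {μ : ℕ}
    (h : G.IsNonlocalBridging μ) : G.IsCycleBridging (μ + 1) := by
  intro a C hC v hv x hx y hy hxv hyv hxy
  have hne : x ≠ y := by
    rintro rfl
    simp at hxy
  obtain ⟨A, hA, hAv, hAs, -⟩ := exists_arcs hC hv hx hy hxv hyv hne
  have hAC : ∀ l, A.getVert l ∈ C.support := fun l =>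
    mem_support_of_spanningCoe_walk hx A (A.getVert_mem_support l)
  have hdG : ∀ i j, i ≤ j → j ≤ 2 * (μ + 1) → G.dist (A.getVert i) (A.getVert j) = j - i := by
    intro i j hij hj
    have := Walk.dist_getVert (p := A.mapLe (Subgraph.spanningCoe_le _)) (by simp [hA, hxy])
      hij (by simpa [hA] using hj)
    simpa using this
  have hdC : ∀ i j, i ≤ j → j ≤ 2 * (μ + 1) → cycleDist C (A.getVert i) (A.getVert j) = j - i := by
    intro i j hij hj
    apply le_antisymm
    · obtain ⟨q, hq, -⟩ := A.exists_slice hij (by omega)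
      exact hq ▸ dist_le q
    · rw [← hdG i j hij hj]
      exact dist_le_cycleDist (hAC i) (hAC j)
  -- The segment of `A` of length `μ + 1` centred at `v`, up to rounding: its vertices are within
  -- `⌈(μ + 1) / 2⌉` of `v`, which together with a bridge of length `⌊(μ + 1) / 2⌋` gives `μ + 1`.
  obtain ⟨i, hi⟩ : ∃ i, i = (μ + 1) - (μ + 1) / 2 := ⟨_, rfl⟩
  obtain ⟨P, hP, hPA, hPv⟩ := A.exists_slice (i := i) (j := i + (μ + 1)) (by omega) (by omega)
  have hdCi := hdC i (i + (μ + 1)) (by omega) (by omega)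
  have hdGi := hdG i (i + (μ + 1)) (by omega) (by omega)
  have hPpath : P.IsPath := P.isPath_of_length_eq_dist (by
    rw [hP]; exact hdCi.symm)
  obtain ⟨s, hs, z, hzS, -, hz, hsz1, hsz2⟩ := h a C hC
    (fun hloc => by
      have := hloc _ (hAC i) _ (hAC (i + (μ + 1))) (μ + 1) (by omega) (by omega)
      omega)
    {z | z ∈ P.support}
    ⟨_, hAC i, _, hAC (i + (μ + 1)), by omega, by omega, P, hPpath, by omega, rfl⟩
  obtain ⟨l, rfl, hl⟩ := Walk.mem_support_iff_exists_getVert.1 hs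
  rw [hP] at hl
  rw [hPv l hl] at hsz1 hsz2
  refine ⟨z, hz, ?_, ?_⟩
  · have htri := hG.dist_triangle (u := v) (v := A.getVert (i + l)) (w := z)
    have hvl : G.dist v (A.getVert (i + l)) ≤ i := by
      rw [← hAv]
      rcases le_total (i + l) (μ + 1) with h1 | h1
      · rw [dist_comm, hdG _ _ h1 (by omega)]; omega
      · rw [hdG _ _ h1 (by omega)]; omega
    omega
  -- Otherwise `z` lies on `A`, where distances in `G` and in the cycle agree, and no bridge is
  -- possible.
  · by_contra hzk
    obtain ⟨t, rfl, ht⟩ := Walk.mem_support_iff_exists_getVert.1 (hAs z hz (by omega))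
    rcases le_total (i + l) t with h1 | h1
    · rw [hdG _ _ h1 (by omega)] at hsz1
      rw [hdC _ _ h1 (by omega)] at hsz2
      omega
    · rw [dist_comm, hdG _ _ h1 (by omega)] at hsz1
      rw [cycleDist_comm, hdC _ _ h1 (by omega)] at hsz2
      omega

end SimpleGraph
-- Bottleneck bounds from approximating trees and from separating disks
namespace SimpleGraph

variable {V : Type*} {G T : SimpleGraph V}

/-- Every walk of `T` between `x` and `y` passes through `p`. -/
def IsBetween (T : SimpleGraph V) (x p y : V) : Prop :=
  ∀ q : T.Walk x y, p ∈ q.support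

theorem Walk.dist_add_dist {u v p : V} {q : G.Walk u v} (hq : q.length = G.dist u v)
    (hp : p ∈ q.support) : G.dist u p + G.dist p v = G.dist u v := by
  obtain ⟨i, rfl, hi⟩ := Walk.mem_support_iff_exists_getVert.1 hp
  have h1 := Walk.dist_getVert hq (Nat.zero_le i) hi
  have h2 := Walk.dist_getVert hq hi le_rfl
  rw [Walk.getVert_zero] at h1
  rw [Walk.getVert_length] at h2
  omega

theorem IsBetween.dist_add_dist (hT : T.Connected) {x p y : V} (h : T.IsBetween x p y) :
    T.dist x p + T.dist p y = T.dist x y := by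
  obtain ⟨q, hq⟩ := hT.exists_walk_length_eq_dist x y
  exact Walk.dist_add_dist hq (h q)

theorem IsBetween.or {x p y : V} (h : T.IsBetween x p y) (w : V) :
    T.IsBetween x p w ∨ T.IsBetween w p y := by
  unfold IsBetween at *
  by_contra! hc
  obtain ⟨⟨q₁, h₁⟩, q₂, h₂⟩ := hc
  have := h (q₁.append q₂)
  rw [Walk.mem_support_append_iff] at this
  tauto

theorem IsTree.isBetween (hT : T.IsTree) {x p y : V} {q : T.Walk x y} (hq : q.IsPath)
    (hp : p ∈ q.support) : T.IsBetween x p y := by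
  classical
  intro q'
  have := (hT.existsUnique_path x y).unique hq q'.bypass_isPath
  rw [this] at hp
  exact q'.support_bypass_subset_support hp

/-- `Q` is a walk of `G`, not of `T`, so it may miss `p`, but one of its steps must jump across `p`.
The trivial walk gives `a = b`, hence `≤ 1` instead of adjacency. -/
theorem IsBetween.exists_adj {u v p : V} (h : T.IsBetween u p v) (Q : G.Walk u v) :
    ∃ a ∈ Q.support, ∃ b ∈ Q.support, G.dist a b ≤ 1 ∧ T.IsBetween a p b := by
  induction Q with
  | @nil u => exact ⟨u, by simp, u, by simp, by simp, h⟩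
  | @cons u w v huw Q ih =>
    rcases h.or w with h1 | h1
    · exact ⟨u, by simp, w, by simp, (dist_eq_one_iff_adj.2 huw).le, h1⟩
    · obtain ⟨a, ha, b, hb, hab⟩ := ih h1
      exact ⟨a, by simp [ha], b, by simp [hb], hab⟩

/-- In a tree, some vertex on the path between `u` and `v` is roughly as close to `w` as the Gromov
product of `u` and `v` at `w`. -/
theorem IsTree.exists_isBetween (hT : T.IsTree) (u v w : V) :
    ∃ p, T.IsBetween u p v ∧ 2 * T.dist p w + T.dist u v ≤ T.dist u w + T.dist w v + 1 := by
  classical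
  obtain ⟨R, hR, hRl⟩ := hT.connected.exists_path_of_dist u v
  have hB : ∀ i, T.IsBetween u (R.getVert i) v := fun i => hT.isBetween hR (R.getVert_mem_support i)
  -- Along the tree path from `u` to `v`, `p` is the vertex just before the first one not between
  -- `u` and `w`, and `p'` is that first one (if there is none, `p = p' = v`). The one closer to `w`
  -- works; the edge from `p` to `p'` costs the `+ 1`.
  obtain ⟨p, p', hp, hp', hpw, hpw', hd⟩ : ∃ p p', T.IsBetween u p v ∧ T.IsBetween u p' v ∧
      T.IsBetween u p w ∧ T.IsBetween w p' v ∧ T.dist u v ≤ T.dist u p + T.dist p' v + 1 := by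
    by_cases hall : T.IsBetween u v w
    · have hv : T.IsBetween u v v := fun q => q.end_mem_support
      exact ⟨v, v, hv, hv, hall, fun q => q.end_mem_support, by omega⟩
    · have hex : ∃ i, ¬ T.IsBetween u (R.getVert i) w := ⟨R.length, by simpa using hall⟩
      have h1 := Nat.find_spec hex
      have hle : Nat.find hex ≤ R.length := Nat.find_min' hex (by simpa using hall)
      have hpos : Nat.find hex ≠ 0 := by
        intro h0
        rw [h0, Walk.getVert_zero] at h1
        exact h1 fun q => q.start_mem_support
      have h2 := Nat.find_min hex (m := Nat.find hex - 1) (by omega)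
      rw [not_not] at h2
      refine ⟨_, _, hB (Nat.find hex - 1), hB (Nat.find hex), h2,
        ((hB _).or w).resolve_left h1, ?_⟩
      have h3 := Walk.dist_getVert hRl (Nat.zero_le (Nat.find hex - 1)) (by omega)
      have h4 := Walk.dist_getVert hRl hle le_rfl
      rw [Walk.getVert_zero] at h3
      rw [Walk.getVert_length] at h4
      omega
  have h1 := hpw.dist_add_dist hT.connected
  have h2 := hpw'.dist_add_dist hT.connected
  have hc : T.dist w p' = T.dist p' w := dist_comm
  rcases le_total (T.dist p w) (T.dist p' w) with h | h
  · exact ⟨p, hp, by omega⟩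
  · exact ⟨p', hp', by omega⟩

/-- In `T`, the vertex `p` is within `(3 * k + 1) / 2` of `w`, and the nearer end of the step of `Q`
across `p` is within `(k + 1) / 2` of `p`. The sum is `2 * k + 1`, and returning to `G` adds `k`. -/
theorem IsDistApproxTree.isBottleneckBound {k : ℕ} (h : G.IsDistApproxTree T k) :
    G.IsBottleneckBound (3 * k + 1) := by
  obtain ⟨hT, hd⟩ := h
  have hd' : ∀ x y, G.dist x y ≤ T.dist x y + k ∧ T.dist x y ≤ G.dist x y + k := by
    intro x y
    have := abs_le.1 (hd x y)
    omega
  intro u v P hP hE Q hQ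
  have hm := Walk.dist_getVert hP (Nat.zero_le (P.length / 2)) (by omega)
  have hm' := Walk.dist_getVert hP (i := P.length / 2) (by omega) le_rfl
  rw [Walk.getVert_zero] at hm
  rw [Walk.getVert_length] at hm'
  generalize P.getVert (P.length / 2) = w at hm hm' ⊢
  obtain ⟨p, hp, hpw⟩ := hT.exists_isBetween u v w
  obtain ⟨a, ha, b, hb, hab, hpab⟩ := hp.exists_adj Q
  have h1 := hpab.dist_add_dist hT.connected
  have h2 := (hd' a b).2
  have h3 := (hd' u w).2
  have h4 := (hd' w v).2
  have h5 := (hd' u v).1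
  have hE' : 2 * (P.length / 2) = P.length := Nat.two_mul_div_two_of_even hE
  have hc : T.dist p w = T.dist w p := dist_comm
  rcases le_total (T.dist a p) (T.dist p b) with h | h
  · refine ⟨a, ha, ?_⟩
    have h6 := hT.connected.dist_triangle (u := w) (v := p) (w := a)
    have h7 := (hd' w a).1
    rw [dist_comm (u := p) (v := a)] at h6
    omega
  · refine ⟨b, hb, ?_⟩
    have h6 := hT.connected.dist_triangle (u := w) (v := p) (w := b)
    have h7 := (hd' w b).1
    omega

theorem forall_component_iff_forall_walk {D : Set V} {S : Set V} :
    (∀ K : (G.induce Dᶜ).ConnectedComponent, ¬ ∃ p ∈ S, ∃ q ∈ S, p ≠ q ∧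
        p ∈ Subtype.val '' K.supp ∧ q ∈ Subtype.val '' K.supp) ↔
      ∀ p ∈ S, ∀ q ∈ S, p ≠ q → ∀ W : G.Walk p q, ∃ z ∈ W.support, z ∈ D := by
  constructor
  · intro h p hp q hq hpq W
    by_contra! hW
    let W' := W.induce Dᶜ hW
    exact h ((G.induce Dᶜ).connectedComponentMk ⟨p, hW p W.start_mem_support⟩)
      ⟨p, hp, q, hq, hpq, ⟨_, rfl, rfl⟩, ⟨_, ConnectedComponent.sound W'.reachable.symm, rfl⟩⟩
  · rintro h K ⟨p, hp, q, hq, hpq, ⟨p', hp', rfl⟩, ⟨q', hq', rfl⟩⟩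
    obtain ⟨W⟩ := K.reachable_of_mem_supp hp' hq'
    obtain ⟨z, hz, hzD⟩ := h _ hp _ hq hpq (W.map (Embedding.induce Dᶜ).toHom)
    have hz' : z ∈ W.support.map (Embedding.induce (G := G) Dᶜ).toHom := by
      rw [← Walk.support_map]
      exact hz
    obtain ⟨z', -, rfl⟩ := List.mem_map.1 hz'
    exact z'.2 hzD

/-- Separate the middle of `P` from the two vertices of `P` at distance `3 * r + 1` from it. The
disk meets `P` on both sides of the middle in vertices at most `2 * r` apart, so one is within `r`
of the middle and the whole disk is within `3 * r`. It therefore misses the detour along `Q`. -/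
theorem IsMcCartyBound.isBottleneckBound (hG : G.Connected) {r : ℕ} (h : G.IsMcCartyBound r) :
    G.IsBottleneckBound (3 * r) := by
  intro u v P hP hE Q hQ
  by_contra! hfar
  obtain ⟨m, hm⟩ : ∃ m, m = P.length / 2 := ⟨_, rfl⟩
  have h2m : P.length = 2 * m := by obtain ⟨t, ht⟩ := hE; omega
  rw [← hm] at hfar
  have hdw : ∀ l ≤ P.length, G.dist (P.getVert m) (P.getVert l) = (l - m) + (m - l) := by
    intro l hl
    rcases le_total l m with hlm | hlm
    · rw [dist_comm, Walk.dist_getVert hP hlm (by omega)]; omega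
    · rw [Walk.dist_getVert hP hlm hl]; omega
  have hkm : 3 * r < m := by
    have := hfar u Q.start_mem_support
    have h0 := hdw 0 (by omega)
    rw [Walk.getVert_zero] at h0
    omega
  have hne : ∀ {i j}, i < j → j ≤ P.length → P.getVert i ≠ P.getVert j := by
    intro i j hij hj he
    have := Walk.dist_getVert hP hij.le hj
    rw [he, dist_self] at this
    omega
  obtain ⟨x, hx⟩ := h (P.getVert (m - 3 * r - 1)) (P.getVert m) (P.getVert (m + 3 * r + 1))
    (hne (by omega) (by omega)) (hne (by omega) (by omega)) (hne (by omega) (by omega))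
  rw [forall_component_iff_forall_walk] at hx
  obtain ⟨W₁, hW₁, -, hWv₁⟩ := P.exists_slice (i := m - 3 * r - 1) (j := m) (by omega) (by omega)
  obtain ⟨W₂, hW₂, -, hWv₂⟩ := P.exists_slice (i := m) (j := m + 3 * r + 1) (by omega) (by omega)
  obtain ⟨z₁, hz₁, hd₁⟩ := hx _ (by simp) _ (by simp) (hne (by omega) (by omega)) W₁
  obtain ⟨z₂, hz₂, hd₂⟩ := hx _ (by simp) _ (by simp) (hne (by omega) (by omega)) W₂
  obtain ⟨z₃, hz₃, hd₃⟩ := hx _ (by simp) _ (by simp) (hne (by omega) (by omega))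
    (((P.take (m - 3 * r - 1)).reverse.append Q).append (P.drop (m + 3 * r + 1)).reverse)
  obtain ⟨i, rfl, hi⟩ := Walk.mem_support_iff_exists_getVert.1 hz₁
  obtain ⟨j, rfl, hj⟩ := Walk.mem_support_iff_exists_getVert.1 hz₂
  rw [hWv₁ i (by omega)] at hd₁
  rw [hWv₂ j (by omega)] at hd₂
  have hfar₃ : 3 * r < G.dist (P.getVert m) z₃ := by
    rw [Walk.mem_support_append_iff, Walk.mem_support_append_iff] at hz₃
    rcases hz₃ with (h1 | h1) | h1
    · rw [Walk.support_reverse, List.mem_reverse] at h1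
      obtain ⟨l, rfl, hl⟩ := Walk.mem_support_iff_exists_getVert.1 h1
      rw [Walk.take_length] at hl
      rw [Walk.take_getVert, min_eq_right (by omega), hdw _ (by omega)]
      omega
    · exact hfar _ h1
    · rw [Walk.support_reverse, List.mem_reverse] at h1
      obtain ⟨l, rfl, hl⟩ := Walk.mem_support_iff_exists_getVert.1 h1
      rw [Walk.drop_length] at hl
      rw [Walk.drop_getVert, hdw _ (by omega)]
      omega
  simp only [disk, Set.mem_ofPred_eq] at hd₁ hd₂ hd₃
  have h12 := Walk.dist_getVert hP (i := m - 3 * r - 1 + i) (j := m + j) (by omega) (by omega)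
  have ht := hG.dist_triangle (u := P.getVert (m - 3 * r - 1 + i)) (v := x) (w := P.getVert (m + j))
  rw [dist_comm (u := x)] at ht
  have hw₁ := hdw (m - 3 * r - 1 + i) (by omega)
  have hw₂ := hdw (m + j) (by omega)
  have ht₁ := hG.dist_triangle (u := P.getVert m) (v := P.getVert (m - 3 * r - 1 + i)) (w := x)
  have ht₂ := hG.dist_triangle (u := P.getVert m) (v := P.getVert (m + j)) (w := x)
  have ht₃ := hG.dist_triangle (u := P.getVert m) (v := x) (w := z₃)
  rw [dist_comm (u := x)] at ht₃
  omega

end SimpleGraph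
namespace SimpleGraph

variable {V : Type*} {G H T : SimpleGraph V} {s x y z : V} {i j : ℕ}

theorem exists_not_succ {P : ℕ → Prop} (h0 : P 0) {n : ℕ} (hn : ¬ P n) :
    ∃ j, P j ∧ ¬ P (j + 1) := by
  by_contra! h
  exact hn (Nat.rec h0 (fun j hj => h j hj) n)

/-! ### Connectivity outside the disks around a root -/

/-- `x` and `y` are connected in `G` by a walk whose vertices are at distance at least `j`
from `s`. -/
def UpReachable (G : SimpleGraph V) (s : V) (j : ℕ) (x y : V) : Prop :=
  ∃ p : G.Walk x y, ∀ z ∈ p.support, j ≤ G.dist s z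

theorem UpReachable.le_left (h : G.UpReachable s j x y) : j ≤ G.dist s x :=
  h.choose_spec x h.choose.start_mem_support

theorem UpReachable.refl (h : j ≤ G.dist s x) : G.UpReachable s j x x :=
  ⟨Walk.nil, by simpa using h⟩

theorem UpReachable.symm (h : G.UpReachable s j x y) : G.UpReachable s j y x := by
  obtain ⟨p, hp⟩ := h
  exact ⟨p.reverse, by simpa using hp⟩

theorem UpReachable.le_right (h : G.UpReachable s j x y) : j ≤ G.dist s y :=
  h.symm.le_left

theorem UpReachable.trans (h : G.UpReachable s j x y) (h' : G.UpReachable s j y z) :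
    G.UpReachable s j x z := by
  obtain ⟨p, hp⟩ := h
  obtain ⟨q, hq⟩ := h'
  refine ⟨p.append q, fun t ht => ?_⟩
  rcases (Walk.mem_support_append_iff _ _).1 ht with h | h
  exacts [hp t h, hq t h]

theorem UpReachable.mono (h : G.UpReachable s j x y) (hij : i ≤ j) : G.UpReachable s i x y := by
  obtain ⟨p, hp⟩ := h
  exact ⟨p, fun t ht => hij.trans (hp t ht)⟩

theorem Adj.upReachable (h : G.Adj x y) (hx : j ≤ G.dist s x) (hy : j ≤ G.dist s y) :
    G.UpReachable s j x y :=
  ⟨h.toWalk, by simp [hx, hy]⟩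

theorem UpReachable.zero (hG : G.Connected) : G.UpReachable s 0 x y :=
  ⟨(hG x y).some, fun _ _ => Nat.zero_le _⟩

theorem Connected.dist_le_dist_add_one (hG : G.Connected) (s : V) (h : G.Adj x y) :
    G.dist s x ≤ G.dist s y + 1 := by
  have := hG.dist_triangle (u := s) (v := y) (w := x)
  rwa [dist_eq_one_iff_adj.2 h.symm] at this

theorem Connected.exists_adj_dist_add_one (hG : G.Connected) (h : x ≠ s) :
    ∃ p, G.Adj x p ∧ G.dist s p + 1 = G.dist s x := by
  obtain ⟨q, hq⟩ := hG.exists_walk_length_eq_dist s x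
  have hpos := hG.pos_dist_of_ne h.symm
  have h1 := q.adj_getVert_succ (i := q.length - 1) (by omega)
  rw [Nat.sub_add_cancel (by omega), Walk.getVert_length] at h1
  refine ⟨_, h1.symm, ?_⟩
  have := Walk.dist_getVert hq (Nat.zero_le (q.length - 1)) (by omega)
  rw [Walk.getVert_zero] at this
  omega

/-- Vertices in the same layer that are connected outside the smaller layers are close to each
other. -/
theorem IsBottleneckBound.dist_le_of_upReachable (hG : G.Connected) {r : ℕ}
    (h : G.IsBottleneckBound r) (hxy : G.UpReachable s j x y) (hx : G.dist s x = j)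
    (hy : G.dist s y = j) : G.dist x y ≤ 4 * r + 2 := by
  have htri := hG.dist_triangle (u := x) (v := s) (w := y)
  rw [dist_comm (u := x) (v := s)] at htri
  rcases le_or_gt j (2 * r + 1) with hj | hj
  · omega
  obtain ⟨X, hX⟩ := hG.exists_walk_length_eq_dist s x
  obtain ⟨Y, hY⟩ := hG.exists_walk_length_eq_dist s y
  obtain ⟨W, hW⟩ := hxy
  have hXl : ∀ l ≤ j, G.dist s (X.getVert l) = l := by
    intro l hl
    have := Walk.dist_getVert hX (Nat.zero_le l) (by omega)
    rwa [Walk.getVert_zero] at this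
  obtain ⟨P, hP, hPX, hPv⟩ := X.exists_slice (i := j - 2 * r - 2) (j := X.length)
    (by omega) le_rfl
  have hmid : P.getVert (P.length / 2) = X.getVert (j - r - 1) := by
    rw [hPv _ (by omega)]; congr 1; omega
  obtain ⟨Q, hQ, hQs⟩ := (((X.take (j - 2 * r - 2)).reverse.append Y).append
    (W.reverse.copy rfl X.getVert_length.symm)).exists_isPath
  obtain ⟨z, hz, hzr⟩ := h _ _ P (length_eq_dist_of_subwalk hX hPX) (by
    rw [hP]; exact ⟨r + 1, by omega⟩) Q hQ
  rw [hmid] at hzr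
  have hw := hXl (j - r - 1) (by omega)
  have hlow := hG.dist_triangle (u := s) (v := z) (w := X.getVert (j - r - 1))
  rw [dist_comm (u := z)] at hlow
  have hzs := hQs z hz
  rw [Walk.mem_support_append_iff, Walk.mem_support_append_iff] at hzs
  rcases hzs with (h1 | h1) | h1
  · rw [Walk.support_reverse, List.mem_reverse] at h1
    obtain ⟨l, rfl, hl⟩ := Walk.mem_support_iff_exists_getVert.1 h1
    rw [Walk.take_length] at hl
    rw [Walk.take_getVert, min_eq_right (by omega)] at hlow hzr
    rw [hXl l (by omega)] at hlow
    omega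
  · obtain ⟨l, rfl, hl⟩ := Walk.mem_support_iff_exists_getVert.1 h1
    have hl1 := Walk.dist_getVert hY (Nat.zero_le l) hl
    have hl2 := Walk.dist_getVert hY hl le_rfl
    rw [Walk.getVert_zero] at hl1
    rw [Walk.getVert_length] at hl2
    have hl3 := Walk.dist_getVert hX (i := j - r - 1) (j := X.length) (by omega) le_rfl
    rw [Walk.getVert_length, dist_comm] at hl3
    have t1 := hG.dist_triangle (u := x) (v := X.getVert (j - r - 1)) (w := Y.getVert l)
    have t2 := hG.dist_triangle (u := x) (v := Y.getVert l) (w := y)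
    omega
  · have h2 := hW z (by simpa using h1)
    have h3 := hG.dist_triangle (u := s) (v := X.getVert (j - r - 1)) (w := z)
    omega

/-- The edges of `H` join vertices of consecutive or equal layers of `G` around `s` in the way the
edges of `G` do, up to connectivity within the outer layers. -/
structure RespectsLayers (G H : SimpleGraph V) (s : V) : Prop where
  dist_le_of_adj : ∀ x y, H.Adj x y → G.dist s x ≤ G.dist s y + 1
  upReachable_of_adj : ∀ x y j, H.Adj x y → j ≤ G.dist s x → j ≤ G.dist s y →
    G.UpReachable s j x y
  exists_adj : ∀ x, x ≠ s → ∃ p, H.Adj x p ∧ G.dist s p + 1 = G.dist s x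

theorem Connected.respectsLayers (hG : G.Connected) (s : V) : G.RespectsLayers G s :=
  ⟨fun _ _ h => hG.dist_le_dist_add_one s h, fun _ _ _ h => h.upReachable,
    fun _ h => hG.exists_adj_dist_add_one h⟩

namespace RespectsLayers

theorem dist_le_length (h : G.RespectsLayers H s) (q : H.Walk x y) :
    G.dist s x ≤ G.dist s y + q.length := by
  induction q with
  | nil => simp
  | cons hxz q ih =>
    have := h.dist_le_of_adj _ _ hxz
    rw [Walk.length_cons]
    omega

theorem dist_le_add_dist (h : G.RespectsLayers H s) (hH : H.Connected) (x y : V) :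
    G.dist s x ≤ G.dist s y + H.dist x y := by
  obtain ⟨q, hq⟩ := hH.exists_walk_length_eq_dist x y
  exact hq ▸ h.dist_le_length q

theorem upReachable (h : G.RespectsLayers H s) (q : H.Walk x y)
    (hq : ∀ z ∈ q.support, j ≤ G.dist s z) : G.UpReachable s j x y := by
  induction q with
  | nil => exact UpReachable.refl (hq _ (by simp))
  | cons hxz q ih =>
    exact (h.upReachable_of_adj _ _ _ hxz (hq _ (by simp)) (hq _ (by simp))).trans
      (ih fun z hz => hq z (by simp [hz]))

/-- Every walk from `x` to `y` in `H` must descend to layer `j` or lower, and each edge changes the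
layer by at most one. -/
theorem dist_add_dist_le (h : G.RespectsLayers H s) (hH : H.Connected)
    (hxy : ¬ G.UpReachable s (j + 1) x y) :
    G.dist s x + G.dist s y ≤ H.dist x y + 2 * j := by
  obtain ⟨q, hq⟩ := hH.exists_walk_length_eq_dist x y
  obtain ⟨z, hz, hzj⟩ : ∃ z ∈ q.support, G.dist s z ≤ j := by
    by_contra! hc
    exact hxy (h.upReachable q hc)
  have h1 := Walk.dist_add_dist hq hz
  have h2 := h.dist_le_add_dist hH x z
  have h3 := h.dist_le_add_dist hH y z
  rw [dist_comm (u := y)] at h3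
  omega

theorem exists_ancestor (h : G.RespectsLayers H s) (hH : H.Connected) {n : ℕ}
    (hx : G.dist s x = j + n) :
    ∃ z, G.dist s z = j ∧ G.UpReachable s j x z ∧ H.dist x z ≤ n := by
  induction n generalizing x with
  | zero => exact ⟨x, hx, UpReachable.refl hx.ge, by simp⟩
  | succ n ih =>
    have hxs : x ≠ s := by
      rintro rfl
      simp at hx
    obtain ⟨p, hp, hpx⟩ := h.exists_adj x hxs
    obtain ⟨z, hz, hpz, hd⟩ := ih (x := p) (by omega)
    refine ⟨z, hz, (h.upReachable_of_adj x p j hp (by omega) (by omega)).trans hpz, ?_⟩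
    have := hH.dist_triangle (u := x) (v := p) (w := z)
    rw [dist_eq_one_iff_adj.2 hp] at this
    omega

end RespectsLayers

/-! ### The layering tree -/

theorem Connected.exists_parent (hG : G.Connected) (s : V) :
    ∃ f : V → V, (∀ x, x ≠ s → G.dist s (f x) + 1 = G.dist s x ∧
        G.UpReachable s (G.dist s (f x)) x (f x)) ∧
      ∀ x y, G.dist s x = G.dist s y → G.UpReachable s (G.dist s x) x y → f x = f y := by
  classical
  -- `K x` is the cluster of `x`. The parent is chosen as a function of the cluster alone, so it
  -- need not be adjacent to `x` in `G`.
  have : Nonempty V := ⟨s⟩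
  let K : V → Set V := fun x => {y | G.dist s x = G.dist s y ∧ G.UpReachable s (G.dist s x) x y}
  let P : Set V → V → Prop := fun S z => ∃ x' ∈ S, G.Adj x' z ∧ G.dist s z + 1 = G.dist s x'
  refine ⟨fun x => Classical.epsilon (P (K x)), ?_, ?_⟩
  · intro x hx
    obtain ⟨p, hp⟩ := hG.exists_adj_dist_add_one hx
    obtain ⟨x', ⟨hx'd, hx'⟩, hadj, hd⟩ : P (K x) (Classical.epsilon (P (K x))) :=
      Classical.epsilon_spec ⟨p, x, ⟨rfl, UpReachable.refl le_rfl⟩, hp⟩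
    beta_reduce
    exact ⟨by omega, (hx'.mono (by omega)).trans (hadj.upReachable (by omega) le_rfl)⟩
  · intro x y hxy hr
    have : K x = K y := by
      ext t
      simp only [K, Set.mem_ofPred_eq, ← hxy]
      exact and_congr_right fun _ => ⟨fun h => hr.symm.trans h, fun h => hr.trans h⟩
    simp only [this]

theorem isTree_fromRel_parent [Finite V] {f : V → V} {ℓ : V → ℕ}
    (hf : ∀ x, x ≠ s → ℓ (f x) < ℓ x) :
    (fromRel fun x y => x ≠ s ∧ y = f x).IsTree := by
  classical
  set T := fromRel fun x y => x ≠ s ∧ y = f x with hT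
  have hadj : ∀ x, x ≠ s → T.Adj x (f x) := by
    intro x hx
    rw [hT, fromRel_adj]
    refine ⟨fun h => ?_, Or.inl ⟨hx, rfl⟩⟩
    have := hf x hx
    rw [← h] at this
    omega
  have hs : ∀ n x, ℓ x ≤ n → T.Reachable x s := by
    intro n
    induction n with
    | zero =>
      intro x hx
      by_cases hxs : x = s
      · rw [hxs]
      · have := hf x hxs
        omega
    | succ n ih =>
      intro x hx
      by_cases hxs : x = s
      · rw [hxs]
      · exact (hadj x hxs).reachable.trans (ih _ (by have := hf x hxs; omega))
  have hconn : T.Connected := by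
    have : Nonempty V := ⟨s⟩
    exact ⟨fun x y => (hs _ x le_rfl).trans (hs _ y le_rfl).symm⟩
  rw [isTree_iff_connected_and_card]
  refine ⟨hconn, le_antisymm ?_ hconn.card_vert_le_card_edgeSet_add_one⟩
  -- Every edge joins a non-root vertex to its parent, so a connected `T` has at most as many edges
  -- as a tree.
  have hsub : T.edgeSet ⊆ (fun x => s(x, f x)) '' ({s}ᶜ : Set V) := by
    intro e
    induction e using Sym2.ind with
    | _ x y =>
      intro he
      rw [mem_edgeSet, hT, fromRel_adj] at he
      rcases he with ⟨-, ⟨h, rfl⟩ | ⟨h, rfl⟩⟩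
      · exact ⟨x, h, rfl⟩
      · exact ⟨y, h, Sym2.eq_swap⟩
  have h1 : T.edgeSet.ncard ≤ ({s}ᶜ : Set V).ncard :=
    (Set.ncard_le_ncard hsub (Set.toFinite _)).trans (Set.ncard_image_le (Set.toFinite _))
  have h2 := Set.ncard_add_ncard_compl ({s} : Set V)
  rw [Set.ncard_singleton] at h2
  rw [Nat.card_coe_set_eq]
  omega

/-- With `j` the last level at which `x` and `y` are connected, both distances are at least `G.dist
s x + G.dist s y - 2 * j`. The excess is at most the cluster diameter `4 * r + 2` in `G`, and at
most `2` in `T`, where vertices of a cluster are siblings. -/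
theorem IsBottleneckBound.exists_isDistApproxTree [Finite V] (hG : G.Connected) {r : ℕ}
    (h : G.IsBottleneckBound r) : ∃ T : SimpleGraph V, G.IsDistApproxTree T (4 * r + 2) := by
  obtain ⟨s⟩ := hG.nonempty
  obtain ⟨f, hf, hfc⟩ := hG.exists_parent s
  have hT := isTree_fromRel_parent (ℓ := G.dist s) (f := f) (s := s) fun x hx => by
    have := (hf x hx).1
    omega
  refine ⟨_, hT, fun x y => ?_⟩
  set T := fromRel fun x y => x ≠ s ∧ y = f x with hTdef
  have hadj : ∀ x, x ≠ s → T.Adj x (f x) := by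
    intro x hx
    rw [hTdef, fromRel_adj]
    refine ⟨fun h => ?_, Or.inl ⟨hx, rfl⟩⟩
    have := (hf x hx).1
    rw [← h] at this
    omega
  have hTL : G.RespectsLayers T s := by
    refine ⟨fun x y hxy => ?_, fun x y j hxy hx hy => ?_, fun x hx => ?_⟩
    · rw [hTdef, fromRel_adj] at hxy
      rcases hxy with ⟨-, ⟨h, rfl⟩ | ⟨h, rfl⟩⟩
      · exact (hf x h).1.ge
      · have := (hf y h).1
        omega
    · rw [hTdef, fromRel_adj] at hxy
      rcases hxy with ⟨-, ⟨h, rfl⟩ | ⟨h, rfl⟩⟩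
      · exact (hf x h).2.mono hy
      · exact ((hf y h).2.mono hx).symm
    · exact ⟨f x, hadj x hx, (hf x hx).1⟩
  have hGL := hG.respectsLayers s
  obtain ⟨j, hj, hj'⟩ := exists_not_succ (P := fun j => G.UpReachable s j x y)
    (UpReachable.zero hG) (n := G.dist s x + 1) (fun h => by have := h.le_left; omega)
  have hjx := hj.le_left
  have hjy := hj.le_right
  have lowG := hGL.dist_add_dist_le hG hj'
  have lowT := hTL.dist_add_dist_le hT.connected hj'
  have upG : G.dist x y + 2 * j ≤ G.dist s x + G.dist s y + (4 * r + 2) := by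
    obtain ⟨x', hx', hxx', hdx⟩ := hGL.exists_ancestor hG (Nat.add_sub_cancel' hjx).symm
    obtain ⟨y', hy', hyy', hdy⟩ := hGL.exists_ancestor hG (Nat.add_sub_cancel' hjy).symm
    have hd := h.dist_le_of_upReachable hG ((hxx'.symm.trans hj).trans hyy') hx' hy'
    have t1 := hG.dist_triangle (u := x) (v := x') (w := y)
    have t2 := hG.dist_triangle (u := x') (v := y') (w := y)
    rw [dist_comm (u := y') (v := y)] at t2
    omega
  have upT : T.dist x y + 2 * j ≤ G.dist s x + G.dist s y + 2 := by
    obtain ⟨x', hx', hxx', hdx⟩ := hTL.exists_ancestor hT.connected (Nat.add_sub_cancel' hjx).symm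
    obtain ⟨y', hy', hyy', hdy⟩ := hTL.exists_ancestor hT.connected (Nat.add_sub_cancel' hjy).symm
    have hd : T.dist x' y' ≤ 2 := by
      by_cases hj0 : j = 0
      · subst hj0
        rw [hG.dist_eq_zero_iff] at hx' hy'
        simp [← hx', ← hy']
      · have hxs : x' ≠ s := by
          rintro rfl
          simp at hx'
          omega
        have hys : y' ≠ s := by
          rintro rfl
          simp at hy'
          omega
        have h1 := dist_eq_one_iff_adj.2 (hadj x' hxs)
        have h2 := dist_eq_one_iff_adj.2 (hadj y' hys)
        rw [← hfc x' y' (by omega) (by rw [hx']; exact (hxx'.symm.trans hj).trans hyy')] at h2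
        have t := hT.connected.dist_triangle (u := x') (v := f x') (w := y')
        rw [dist_comm (u := f x') (v := y')] at t
        omega
    have t1 := hT.connected.dist_triangle (u := x) (v := x') (w := y)
    have t2 := hT.connected.dist_triangle (u := x') (v := y') (w := y)
    rw [dist_comm (u := y') (v := y)] at t2
    omega
  rw [abs_le]
  constructor <;> push_cast <;> omega

/-! ### Separating three vertices by a disk around a cluster -/

/-- The component of `z` in the layers at least `j` can be left only through its vertices in layer
`j`, and `W` avoids these. -/
theorem UpReachable.of_walk (hG : G.Connected) {t t' : V} (h : G.UpReachable s j z t)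
    (W : G.Walk t t') (hW : ∀ x ∈ W.support, G.dist s x = j → ¬ G.UpReachable s j z x) :
    ∀ x ∈ W.support, j + 1 ≤ G.dist s x := by
  induction W with
  | nil =>
    intro x hx
    obtain rfl : x = _ := by simpa using hx
    exact lt_of_le_of_ne h.le_right fun he => hW x (by simp) he.symm h
  | @cons t t₂ t' hadj W ih =>
    have ht : j < G.dist s t :=
      lt_of_le_of_ne h.le_right fun he => hW t (by simp) he.symm h
    have := hG.dist_le_dist_add_one s hadj
    have h₂ := h.trans (hadj.upReachable ht.le (by omega))
    intro x hx
    rcases List.mem_cons.1 (Walk.support_cons hadj W ▸ hx) with rfl | hx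
    · exact ht
    · exact ih h₂ (fun x hx => hW x (by simp [hx])) x hx

/-- Let `j` be the last level at which two of the three vertices are still connected, and `z` a
vertex of their cluster in layer `j`. The disk around `z` covers this cluster, so a walk between two
of the three that avoids it would connect them at level `j + 1`. -/
theorem IsBottleneckBound.isMcCartyBound [Finite V] (hG : G.Connected) {r : ℕ}
    (h : G.IsBottleneckBound r) : G.IsMcCartyBound (4 * r + 2) := by
  intro u v w huv huw hvw
  obtain ⟨s⟩ := hG.nonempty
  obtain ⟨N, hN⟩ := exists_dist_le G
  obtain ⟨j, ⟨p₀, hp₀, q₀, hq₀, hne, hj⟩, hj'⟩ := exists_not_succ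
    (P := fun j => ∃ p ∈ ({u, v, w} : Set V), ∃ q ∈ ({u, v, w} : Set V), p ≠ q ∧
      G.UpReachable s j p q)
    ⟨u, by simp, v, by simp, huv, UpReachable.zero hG⟩ (n := N + 1) (by
      rintro ⟨p, -, q, -, -, hpq⟩
      have := hpq.le_left
      have := hN s p
      omega)
  obtain ⟨z, hz, hpz, -⟩ := (hG.respectsLayers s).exists_ancestor hG
    (Nat.add_sub_cancel' hj.le_left).symm
  refine ⟨z, ?_⟩
  rw [forall_component_iff_forall_walk]
  intro p hp q hq hpq W
  by_contra! hW
  have hW' : ∀ x ∈ W.support, G.dist s x = j → ¬ G.UpReachable s j z x := by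
    intro x hx hxj hzx
    exact hW x hx (h.dist_le_of_upReachable hG hzx.symm hxj hz)
  have hend : G.UpReachable s j z p ∨ G.UpReachable s j z q := by
    -- Two pairs chosen from three vertices share a member.
    have : p = p₀ ∨ p = q₀ ∨ q = p₀ ∨ q = q₀ := by
      simp only [Set.mem_insert_iff, Set.mem_singleton_iff] at hp hq hp₀ hq₀
      grind
    rcases this with rfl | rfl | rfl | rfl
    exacts [Or.inl hpz.symm, Or.inl (hpz.symm.trans hj), Or.inr hpz.symm,
      Or.inr (hpz.symm.trans hj)]
  refine hj' ⟨p, hp, q, hq, hpq, W, ?_⟩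
  rcases hend with h1 | h1
  · exact h1.of_walk hG W hW'
  · simpa using h1.of_walk hG W.reverse (by simpa using hW')

end SimpleGraph

theorem corollary3p32 {V : Type*} [Finite V] (G : SimpleGraph V) (hG : G.Connected) :
    (G.bnc ≤ G.cbc ∧ G.cbc ≤ G.bgc + 1 ∧ G.bgc + 1 ≤ 2 * G.cbc ∧ 2 * G.cbc ≤ 2 * G.bnc + 2) ∧
    (((G.bgc : ℝ) - 3) / 6 ≤ ((G.bnc : ℝ) - 1) / 3 ∧ ((G.bnc : ℝ) - 1) / 3 ≤ (G.adt : ℝ) ∧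
      (G.adt : ℝ) ≤ 4 * (G.bnc : ℝ) + 2 ∧ 4 * (G.bnc : ℝ) + 2 ≤ 4 * (G.bgc : ℝ) + 6) ∧
    (((G.bgc : ℝ) - 1) / 6 ≤ (G.mcw : ℝ) ∧ (G.mcw : ℝ) ≤ 4 * (G.bgc : ℝ) + 6) := by
  obtain ⟨bnc_mem, bnc_le⟩ := G.isLeast_bnc
  obtain ⟨⟨cbc_pos, cbc_mem⟩, cbc_le⟩ := G.isLeast_cbc
  obtain ⟨⟨bgc_pos, bgc_mem⟩, bgc_le⟩ := G.isLeast_bgc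
  obtain ⟨⟨T, adt_mem⟩, adt_le⟩ := G.isLeast_adt hG
  obtain ⟨mcw_mem, mcw_le⟩ := G.isLeast_mcw
  have h1 : G.bnc ≤ G.cbc := bnc_le (cbc_mem.isBottleneckBound cbc_pos)
  have h2 : G.cbc ≤ G.bgc + 1 := cbc_le ⟨by omega, bgc_mem.isCycleBridging hG⟩
  have h3 : G.bgc ≤ 2 * G.cbc - 1 := bgc_le ⟨by omega, cbc_mem.isNonlocalBridging cbc_pos⟩
  have h4 : G.cbc ≤ G.bnc + 1 := cbc_le ⟨by omega, bnc_mem.isCycleBridging hG⟩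
  have h5 : G.bnc ≤ 3 * G.adt + 1 := bnc_le adt_mem.isBottleneckBound
  have h6 : G.adt ≤ 4 * G.bnc + 2 := adt_le (bnc_mem.exists_isDistApproxTree hG)
  have h7 : G.bnc ≤ 3 * G.mcw := bnc_le (mcw_mem.isBottleneckBound hG)
  have h8 : G.mcw ≤ 4 * G.bnc + 2 := mcw_le (bnc_mem.isMcCartyBound hG)
  have h9 : (G.bgc : ℝ) ≤ 2 * G.bnc + 1 := by
    have : G.bgc ≤ 2 * G.bnc + 1 := by omega
    exact_mod_cast this
  have h10 : (G.bnc : ℝ) ≤ G.bgc + 1 := by exact_mod_cast h1.trans h2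
  have h5' : (G.bnc : ℝ) ≤ 3 * G.adt + 1 := by exact_mod_cast h5
  have h6' : (G.adt : ℝ) ≤ 4 * G.bnc + 2 := by exact_mod_cast h6
  have h7' : (G.bnc : ℝ) ≤ 3 * G.mcw := by exact_mod_cast h7
  have h8' : (G.mcw : ℝ) ≤ 4 * G.bnc + 2 := by exact_mod_cast h8
  refine ⟨⟨h1, h2, by omega, by omega⟩, ⟨?_, ?_, ?_, ?_⟩, ?_, ?_⟩ <;> linarith
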